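/- Consider real solutions $y$ of the first Painlevé equation $y''=6y^2-x$, each taken on its interval of existence, i.e. its maximal open interval of existence in $\mathbb R$. For $x_0\le 0$ let $$X_{min}(x_0)=\inf_{y_0\in\mathbb R,\ y_1\ge 0} x_{min},$$ where $x_{min}=x_{min}(x_0,y_0,y_1)\le x_0$ is the point at which the solution with $y(x_0)=y_0$, $y'(x_0)=y_1$ attains its minimum over the part of its interval of existence in $(-\infty,x_0]$. Let $$C=\max_{v<0}\int_0^{+\infty}\frac{dw}{\sqrt{w^4+3vw^2+3v^2+1/2}}.$$ The maximum defining $C$ is attained, and $X_{min}(x_0)$ is finite for every $x_0\le 0$. Moreover: 1. For every $x_0\le 0$ the equation $\eta^5-|x_0|\eta=C$ has a unique positive root $\eta(x_0)$, and $$X_{min}(x_0)<-\eta(x_0)^4=x_0-\frac{C}{\eta(x_0)}.$$ 2. For every $x_0<0$, $$x_0-\frac{C}{|x_0|^{1/4}}<X_{min}(x_0)<x_0-\frac{C}{\big||x_0|+C/|x_0|^{1/4}\big|^{1/4}}.$$ 3. As $x_0\to-\infty$, $$X_{min}(x_0)=x_0-\frac{C}{|x_0|^{1/4}}+R(x_0),\qquad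 R(x_0)=\mathcal O\big(|x_0|^{-3/2}\big),$$ and $0<R(x_0)<\dfrac{C^2}{4|x_0|^{3/2}}$ whenever $x_0\le 0$ and $|x_0|>C^{4/5}$. -/

import Mathlib

namespace PainleveOne

/-- `y` is a (real, twice differentiable) solution of `y'' = 6 y ^ 2 - x` on the open
interval `I`, which may be bounded or unbounded on either side. Only the values of `y` on `I`
matter. -/
structure IsSolution (y : ℝ → ℝ) (I : Set ℝ) : Prop where
  isOpen : IsOpen I
  ordConnected : I.OrdConnected
  hasDerivAt : ∀ x ∈ I, HasDerivAt y (deriv y x) x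
  hasDerivAt_deriv : ∀ x ∈ I, HasDerivAt (deriv y) (6 * y x ^ 2 - x) x

/-- `y` is a solution with (maximal) interval of existence `I`: it is not the restriction of a
solution on a larger open interval. -/
def IsMaximalSolution (y : ℝ → ℝ) (I : Set ℝ) : Prop :=
  IsSolution y I ∧
    ∀ (z : ℝ → ℝ) (J : Set ℝ), IsSolution z J → I ⊆ J → Set.EqOn z y I → J = I

/-- `m` is a point at which the maximal solution with initial values `y(x₀) = y₀`,
`y'(x₀) = y₁` attains its minimum over the part of its interval of existence that is not to the
right of `x₀`. -/
def IsMinPoint (x₀ y₀ y₁ m : ℝ) : Prop :=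
  ∃ (y : ℝ → ℝ) (I : Set ℝ), IsMaximalSolution y I ∧
    x₀ ∈ I ∧ y x₀ = y₀ ∧ deriv y x₀ = y₁ ∧
    m ∈ I ∩ Set.Iic x₀ ∧ IsMinOn y (I ∩ Set.Iic x₀) m

/-- The positions of the minima of all the solutions with nonnegative slope at `x₀`. -/
def minPoints (x₀ : ℝ) : Set ℝ :=
  {m | ∃ y₀ y₁ : ℝ, 0 ≤ y₁ ∧ IsMinPoint x₀ y₀ y₁ m}

/-- `X_min(x₀)`, the infimum of the positions of the minima. -/
noncomputable def Xmin (x₀ : ℝ) : ℝ := sInf (minPoints x₀)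

/-- `∫₀^∞ dw / √(w⁴ + 3 v w² + 3 v² + 1/2)`; the radicand is positive for all real `v`, `w`. -/
noncomputable def ellipticIntegral (v : ℝ) : ℝ :=
  ∫ w in Set.Ioi (0 : ℝ), 1 / Real.sqrt (w ^ 4 + 3 * v * w ^ 2 + 3 * v ^ 2 + 1 / 2)

/-- The constant `C`, the maximum over `v < 0` of the integral above. -/
noncomputable def C : ℝ := sSup (ellipticIntegral '' Set.Iio 0)

end PainleveOne

open Set Filter Topology MeasureTheory

namespace PainleveOne

/-! For x ≤ 0 every solution is convex, so it has at most one critical point there, and such a point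
m is its minimum. To the right of m the solution is compared with the autonomous equation y'' = 6y²
+ c, whose first integral is y'² = 4(y³ - a³) + 2c(y - a), a being the minimum value. The
substitution y = a + s² removes the singularity at the minimum and turns elapsed time into ∫ ds /
√(`radicand a c s`). By scaling, the largest blow-up time over all a for the force c⁴ is C / c.

On [m, x₀] the force -x decreases from -m to -x₀. It is at least |x₀| = c⁴, so a solution reaching
x₀ satisfies x₀ - m < C / c. The force is also at most -m = M, so a solution started at rest at -M
blows up no earlier than the autonomous one with force M. If M = η⁴ with η⁵ - |x₀|η = C, the best a
has blow-up time C / η = x₀ + M, exactly the distance to x₀.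

Both comparisons must survive passage to the infimum. For the lower bound, the larger force far to
the left gives a saving of time bounded away from zero in a
(`exists_lt_forall_le_of_deriv_eq_zero`). For the upper bound, the drop of the force during the rise
delays blow-up, so the start can be moved slightly left of -η⁴ (`neg_mem_minPoints`,
`exists_mem_minPoints_lt`). The explicit estimates follow by elementary inequalities for η. -/

/-! ### The regularized time integrand: positivity, domination, limits -/

/-- The radicand of the time integral for `y'' = 6 y ^ 2 + c` with minimum value `a`. -/
noncomputable def radicand (a c s : ℝ) : ℝ := s ^ 4 + 3 * a * s ^ 2 + 3 * a ^ 2 + c / 2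

/-- The difference is (3/4)(s² + 2a)². The bound is free of a and so controls large s uniformly; its
counterpart below, free of s, controls large a. -/
theorem radicand_ge (a c s : ℝ) : s ^ 4 / 4 + c / 2 ≤ radicand a c s := by
  unfold radicand; nlinarith [sq_nonneg (s ^ 2 + 2 * a)]

theorem radicand_ge_sq (a c s : ℝ) : 3 / 4 * a ^ 2 + c / 2 ≤ radicand a c s := by
  unfold radicand; nlinarith [sq_nonneg (2 * s ^ 2 + 3 * a)]

theorem half_le_radicand (a c s : ℝ) : c / 2 ≤ radicand a c s := by
  have := radicand_ge a c s
  have : 0 ≤ s ^ 4 := by positivity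
  linarith

theorem radicand_pos {c : ℝ} (a : ℝ) (hc : 0 < c) (s : ℝ) : 0 < radicand a c s := by
  have := half_le_radicand a c s
  linarith

theorem continuous_radicand (a c : ℝ) : Continuous (radicand a c) := by
  unfold radicand; fun_prop

/-- The integrand of the time integral. -/
noncomputable def slowness (a c s : ℝ) : ℝ := 1 / √(radicand a c s)

theorem slowness_pos {c : ℝ} (a : ℝ) (hc : 0 < c) (s : ℝ) : 0 < slowness a c s :=
  one_div_pos.2 (Real.sqrt_pos.2 (radicand_pos a hc s))

theorem continuous_slowness {c : ℝ} (a : ℝ) (hc : 0 < c) : Continuous (slowness a c) := by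
  unfold slowness
  exact continuous_const.div (continuous_radicand a c).sqrt
    fun s => (Real.sqrt_pos.2 (radicand_pos a hc s)).ne'

theorem slowness_antitone {c d : ℝ} (a : ℝ) (hc : 0 < c) (hcd : c ≤ d) (s : ℝ) :
    slowness a d s ≤ slowness a c s := by
  unfold slowness
  refine one_div_le_one_div_of_le (Real.sqrt_pos.2 (radicand_pos a hc s)) (Real.sqrt_le_sqrt ?_)
  unfold radicand; linarith

theorem slowness_strictAnti {c d : ℝ} (a : ℝ) (hc : 0 < c) (hcd : c < d) (s : ℝ) :
    slowness a d s < slowness a c s := by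
  unfold slowness
  refine one_div_lt_one_div_of_lt (Real.sqrt_pos.2 (radicand_pos a hc s))
    (Real.sqrt_lt_sqrt (radicand_pos a hc s).le ?_)
  unfold radicand; linarith

/-- One integrable majorant serves for all a and all c ≥ c₀, which is what dominated convergence
needs below. -/
theorem exists_slowness_le {c₀ : ℝ} (hc₀ : 0 < c₀) :
    ∃ K : ℝ, ∀ a c s : ℝ, c₀ ≤ c → slowness a c s ≤ K * (1 + s ^ 2)⁻¹ := by
  obtain ⟨k, hk, h1, h2⟩ : ∃ k : ℝ, 0 < k ∧ k ≤ 1 / 8 ∧ k ≤ c₀ / 4 :=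
    ⟨min (1 / 8) (c₀ / 4), by positivity, min_le_left _ _, min_le_right _ _⟩
  refine ⟨1 / √k, fun a c s hc => ?_⟩
  have h : √k * (1 + s ^ 2) ≤ √(radicand a c s) := by
    refine Real.le_sqrt_of_sq_le ?_
    rw [mul_pow, Real.sq_sqrt hk.le]
    have := radicand_ge a c s
    have h3 : (1 + s ^ 2) ^ 2 ≤ 2 + 2 * s ^ 4 := by nlinarith [sq_nonneg (s ^ 2 - 1)]
    have h4 : 0 ≤ s ^ 4 := by positivity
    nlinarith
  have hp : 0 < √k * (1 + s ^ 2) := by positivity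
  calc slowness a c s ≤ 1 / (√k * (1 + s ^ 2)) := one_div_le_one_div_of_le hp h
    _ = _ := by rw [← one_div_mul_one_div, one_div (1 + s ^ 2)]

theorem integrable_slowness {c : ℝ} (a : ℝ) (hc : 0 < c) : Integrable (slowness a c) := by
  obtain ⟨K, hK⟩ := exists_slowness_le hc
  refine (integrable_inv_one_add_sq.const_mul K).mono'
    (continuous_slowness a hc).aestronglyMeasurable (Eventually.of_forall fun s => ?_)
  rw [Real.norm_of_nonneg (slowness_pos a hc s).le]
  exact hK a c s le_rfl

theorem continuousAt_setIntegral_slowness (S : Set ℝ) {p : ℝ × ℝ} (hp : 0 < p.2) :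
    ContinuousAt (fun q : ℝ × ℝ => ∫ s in S, slowness q.1 q.2 s) p := by
  obtain ⟨K, hK⟩ := exists_slowness_le (half_pos hp)
  have hev : ∀ᶠ q : ℝ × ℝ in 𝓝 p, p.2 / 2 < q.2 :=
    continuous_snd.continuousAt.eventually (lt_mem_nhds (half_lt_self hp))
  refine continuousAt_of_dominated (bound := fun s => K * (1 + s ^ 2)⁻¹) ?_ ?_
    (integrable_inv_one_add_sq.const_mul K).integrableOn ?_
  · filter_upwards [hev] with q hq
    exact (continuous_slowness q.1 ((half_pos hp).trans hq)).aestronglyMeasurable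
  · filter_upwards [hev] with q hq
    refine Eventually.of_forall fun s => ?_
    rw [Real.norm_of_nonneg (slowness_pos _ ((half_pos hp).trans hq) s).le]
    exact hK _ _ _ hq.le
  · refine Eventually.of_forall fun s => ?_
    unfold slowness
    refine ContinuousAt.div continuousAt_const (ContinuousAt.sqrt ?_)
      (Real.sqrt_pos.2 (radicand_pos _ hp s)).ne'
    unfold radicand; fun_prop

theorem tendsto_setIntegral_slowness_cocompact (S : Set ℝ) {c : ℝ} (hc : 0 < c) :
    Tendsto (fun a => ∫ s in S, slowness a c s) (cocompact ℝ) (𝓝 0) := by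
  obtain ⟨K, hK⟩ := exists_slowness_le hc
  have : IsCountablyGenerated (cocompact ℝ) := by
    rw [cocompact_eq_atBot_atTop]; infer_instance
  have h := tendsto_integral_filter_of_dominated_convergence (μ := volume.restrict S)
    (l := cocompact ℝ) (F := fun a s => slowness a c s) (f := fun _ => (0 : ℝ))
    (fun s => K * (1 + s ^ 2)⁻¹)
    (Eventually.of_forall fun a => (continuous_slowness a hc).aestronglyMeasurable)
    (Eventually.of_forall fun a => Eventually.of_forall fun s => by
      rw [Real.norm_of_nonneg (slowness_pos _ hc s).le]; exact hK _ _ _ le_rfl)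
    (integrable_inv_one_add_sq.const_mul K).integrableOn
    (Eventually.of_forall fun s => ?_)
  · simpa using h
  · have hlim : Tendsto (fun a : ℝ => 2 * |a|⁻¹) (cocompact ℝ) (𝓝 0) := by
      simpa using
        (tendsto_inv_atTop_zero.comp (tendsto_norm_cocompact_atTop (E := ℝ))).const_mul 2
    refine squeeze_zero' (Eventually.of_forall fun a => (slowness_pos a hc s).le) ?_ hlim
    filter_upwards [(isCompact_singleton (x := (0 : ℝ))).compl_mem_cocompact] with a ha
    have ha : 0 < |a| := abs_pos.2 ha
    have h : |a| / 2 ≤ √(radicand a c s) := by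
      refine Real.le_sqrt_of_sq_le ?_
      have := radicand_ge_sq a c s
      rw [div_pow, sq_abs]
      nlinarith [sq_nonneg a]
    calc slowness a c s ≤ 1 / (|a| / 2) := one_div_le_one_div_of_le (by positivity) h
      _ = 2 * |a|⁻¹ := by field_simp

/-! ### Rise and blow-up times of the autonomous equation -/

/-- The time a solution of `y'' = 6 y ^ 2 + c` needs to rise from its minimum `a` to
`a + s ^ 2`. -/
noncomputable def riseTime (a c s : ℝ) : ℝ := ∫ σ in (0 : ℝ)..s, slowness a c σ

/-- The time a solution of `y'' = 6 y ^ 2 + c` needs to blow up from its minimum `a`. -/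
noncomputable def blowupTime (a c : ℝ) : ℝ := ∫ s in Ioi (0 : ℝ), slowness a c s

theorem hasDerivAt_riseTime {c : ℝ} (a : ℝ) (hc : 0 < c) (s : ℝ) :
    HasDerivAt (riseTime a c) (slowness a c s) s :=
  intervalIntegral.integral_hasDerivAt_right
    ((continuous_slowness a hc).intervalIntegrable _ _)
    (continuous_slowness a hc).stronglyMeasurable.stronglyMeasurableAtFilter
    (continuous_slowness a hc).continuousAt

@[simp]
theorem riseTime_zero (a c : ℝ) : riseTime a c 0 = 0 := by simp [riseTime]

theorem strictMono_riseTime {c : ℝ} (a : ℝ) (hc : 0 < c) : StrictMono (riseTime a c) :=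
  strictMono_of_hasDerivAt_pos (hasDerivAt_riseTime a hc) fun s => slowness_pos a hc s

theorem tendsto_riseTime {c : ℝ} (a : ℝ) (hc : 0 < c) :
    Tendsto (riseTime a c) atTop (𝓝 (blowupTime a c)) :=
  intervalIntegral_tendsto_integral_Ioi 0 (integrable_slowness a hc).integrableOn tendsto_id

theorem riseTime_lt_blowupTime {c : ℝ} (a : ℝ) (hc : 0 < c) (s : ℝ) :
    riseTime a c s < blowupTime a c :=
  (strictMono_riseTime a hc (lt_add_one s)).trans_le
    ((strictMono_riseTime a hc).monotone.ge_of_tendsto (tendsto_riseTime a hc) _)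

theorem blowupTime_pos {c : ℝ} (a : ℝ) (hc : 0 < c) : 0 < blowupTime a c := by
  simpa using riseTime_lt_blowupTime a hc 0

theorem riseTime_le_mul {c s : ℝ} (a : ℝ) (hc : 0 < c) (hs : 0 ≤ s) :
    riseTime a c s ≤ s / √(c / 2) := by
  have h : ∀ σ ∈ Icc 0 s, slowness a c σ ≤ 1 / √(c / 2) := fun σ _ =>
    one_div_le_one_div_of_le (Real.sqrt_pos.2 (half_pos hc))
      (Real.sqrt_le_sqrt (half_le_radicand a c σ))
  have := intervalIntegral.integral_mono_on (μ := volume) hs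
    ((continuous_slowness a hc).intervalIntegrable _ _)
    (continuous_const.intervalIntegrable _ _) h
  rwa [intervalIntegral.integral_const, sub_zero, smul_eq_mul, mul_one_div] at this

/-- The time gained by lowering the force from `d` to `c` is strictly increasing. -/
theorem strictMono_riseTime_sub {c d : ℝ} (a : ℝ) (hc : 0 < c) (hcd : c < d) :
    StrictMono fun s => riseTime a c s - riseTime a d s :=
  strictMono_of_hasDerivAt_pos
    (fun s => (hasDerivAt_riseTime a hc s).sub (hasDerivAt_riseTime a (hc.trans hcd) s))
    fun s => sub_pos.2 (slowness_strictAnti a hc hcd s)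

theorem riseTime_antitone {c d s : ℝ} (a : ℝ) (hc : 0 < c) (hcd : c ≤ d) (hs : 0 ≤ s) :
    riseTime a d s ≤ riseTime a c s :=
  intervalIntegral.integral_mono_on hs
    ((continuous_slowness a (hc.trans_le hcd)).intervalIntegrable _ _)
    ((continuous_slowness a hc).intervalIntegrable _ _)
    fun σ _ => slowness_antitone a hc hcd σ

theorem continuousAt_blowupTime {p : ℝ × ℝ} (hp : 0 < p.2) :
    ContinuousAt (fun q : ℝ × ℝ => blowupTime q.1 q.2) p :=
  continuousAt_setIntegral_slowness _ hp

theorem continuousAt_riseTime {s : ℝ} (hs : 0 ≤ s) {p : ℝ × ℝ} (hp : 0 < p.2) :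
    ContinuousAt (fun q : ℝ × ℝ => riseTime q.1 q.2 s) p := by
  simp only [riseTime, intervalIntegral.integral_of_le hs]
  exact continuousAt_setIntegral_slowness _ hp

theorem tendsto_blowupTime_cocompact {c : ℝ} (hc : 0 < c) :
    Tendsto (fun a => blowupTime a c) (cocompact ℝ) (𝓝 0) :=
  tendsto_setIntegral_slowness_cocompact _ hc

theorem tendsto_riseTime_cocompact {c s : ℝ} (hc : 0 < c) (hs : 0 ≤ s) :
    Tendsto (fun a => riseTime a c s) (cocompact ℝ) (𝓝 0) := by
  simp only [riseTime, intervalIntegral.integral_of_le hs]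
  exact tendsto_setIntegral_slowness_cocompact _ hc

/-! ### The maximum defining C and the scaling of blow-up times -/

/-- A positive continuous function on the line that vanishes at infinity has a maximum. -/
theorem exists_forall_le_of_tendsto_cocompact {f : ℝ → ℝ} (hf : Continuous f)
    (h0 : 0 < f 0) (hlim : Tendsto f (cocompact ℝ) (𝓝 0)) : ∃ a, ∀ b, f b ≤ f a :=
  hf.exists_forall_ge' 0 ((hlim.eventually (gt_mem_nhds h0)).mono fun _ h => h.le)

theorem ellipticIntegral_eq (v : ℝ) : ellipticIntegral v = blowupTime v 1 := rfl

/-- Substituting s ↦ c s multiplies the radicand by c⁴, hence the integrand by c⁻² and ds by c. -/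
theorem blowupTime_scaling {c : ℝ} (hc : 0 < c) (v : ℝ) :
    blowupTime (c ^ 2 * v) (c ^ 4) = ellipticIntegral v / c := by
  have h := integral_comp_mul_left_Ioi' (slowness (c ^ 2 * v) (c ^ 4)) 0 hc
  have h2 : ∀ s, slowness (c ^ 2 * v) (c ^ 4) (c * s) = (c ^ 2)⁻¹ * slowness v 1 s := by
    intro s
    have : radicand (c ^ 2 * v) (c ^ 4) (c * s) = (c ^ 2) ^ 2 * radicand v 1 s := by
      unfold radicand; ring
    unfold slowness
    rw [this, Real.sqrt_mul (by positivity), Real.sqrt_sq (by positivity)]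
    field_simp
  simp only [h2, mul_zero, integral_const_mul, smul_eq_mul] at h
  rw [blowupTime, ← h, ellipticIntegral_eq, blowupTime]
  field_simp

theorem ellipticIntegral_le_zero {v : ℝ} (hv : 0 ≤ v) :
    ellipticIntegral v ≤ ellipticIntegral 0 := by
  rw [ellipticIntegral_eq, ellipticIntegral_eq]
  refine setIntegral_mono (integrable_slowness v one_pos).integrableOn
    (integrable_slowness 0 one_pos).integrableOn fun s => ?_
  refine one_div_le_one_div_of_le (Real.sqrt_pos.2 (radicand_pos _ one_pos s))
    (Real.sqrt_le_sqrt ?_)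
  unfold radicand
  have : 0 ≤ v * s ^ 2 := by positivity
  nlinarith [sq_nonneg v]

/-- The tangent line inequality for the convex function `1 / √·`. -/
theorem one_div_sqrt_ge {A B : ℝ} (hA : 0 < A) (hB : 0 < B) :
    1 / √A + (A - B) * (1 / (2 * (A * √A))) ≤ 1 / √B := by
  obtain ⟨p, hp, rfl⟩ : ∃ p, 0 < p ∧ A = p ^ 2 :=
    ⟨√A, Real.sqrt_pos.2 hA, (Real.sq_sqrt hA.le).symm⟩
  obtain ⟨q, hq, rfl⟩ : ∃ q, 0 < q ∧ B = q ^ 2 :=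
    ⟨√B, Real.sqrt_pos.2 hB, (Real.sq_sqrt hB.le).symm⟩
  rw [Real.sqrt_sq hp.le, Real.sqrt_sq hq.le]
  have : 1 / q - (1 / p + (p ^ 2 - q ^ 2) * (1 / (2 * (p ^ 2 * p))))
      = (p - q) ^ 2 * (2 * p + q) / (2 * p ^ 3 * q) := by
    field_simp; ring
  have h2 : 0 ≤ (p - q) ^ 2 * (2 * p + q) / (2 * p ^ 3 * q) := by positivity
  linarith

/-- The integral has negative slope at v = 0. Integrating the tangent line inequality for 1/√· at
`radicand 0 1` gives E(-u) ≥ E(0) + 3u I2 - 3u² I1 with I1, I2 > 0, and small u makes the correction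
positive. -/
theorem exists_neg_ellipticIntegral_zero_lt :
    ∃ v < 0, ellipticIntegral 0 < ellipticIntegral v := by
  set k : ℝ → ℝ := fun s => 1 / (2 * (radicand 0 1 s * √(radicand 0 1 s))) with hk
  have hkpos : ∀ s, 0 < k s := fun s => by
    have := radicand_pos 0 one_pos s
    positivity
  have hkc : Continuous k := by
    refine continuous_const.div ?_ fun s => ?_
    · have := continuous_radicand 0 1
      fun_prop
    · have := radicand_pos 0 one_pos s
      positivity
  have hk1 : ∀ s, k s ≤ slowness 0 1 s := by
    intro s
    have h1 := half_le_radicand 0 1 s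
    have h2 := radicand_pos 0 one_pos s
    have h3 := Real.sqrt_pos.2 h2
    refine one_div_le_one_div_of_le h3 ?_
    nlinarith
  have hk2 : ∀ s, s ^ 2 * k s ≤ slowness 0 1 s := by
    intro s
    have h2 := radicand_pos 0 one_pos s
    have h3 := Real.sqrt_pos.2 h2
    have h4 : s ^ 2 ≤ 2 * radicand 0 1 s := by
      unfold radicand; nlinarith [sq_nonneg (s ^ 2 - 1)]
    simp only [hk, slowness]
    rw [mul_one_div, div_le_div_iff₀ (by positivity) h3]
    nlinarith
  have hi1 : Integrable k := (integrable_slowness 0 one_pos).mono' hkc.aestronglyMeasurable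
    (Eventually.of_forall fun s => by
      rw [Real.norm_of_nonneg (hkpos s).le]; exact hk1 s)
  have hi2 : Integrable fun s => s ^ 2 * k s :=
    (integrable_slowness 0 one_pos).mono'
      ((continuous_pow 2).mul hkc).aestronglyMeasurable
      (Eventually.of_forall fun s => by
        rw [Real.norm_of_nonneg (mul_nonneg (sq_nonneg s) (hkpos s).le)]; exact hk2 s)
  have hpos1 : 0 < ∫ s in Ioi (0 : ℝ), k s := by
    rw [setIntegral_pos_iff_support_of_nonneg_ae (Eventually.of_forall fun s => (hkpos s).le)
      hi1.integrableOn]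
    have : Function.support k = univ := by
      ext s; simpa using (hkpos s).ne'
    simp [this]
  have hpos2 : 0 < ∫ s in Ioi (0 : ℝ), s ^ 2 * k s := by
    rw [setIntegral_pos_iff_support_of_nonneg_ae
      (Eventually.of_forall fun s => mul_nonneg (sq_nonneg s) (hkpos s).le) hi2.integrableOn]
    have : Function.support (fun s => s ^ 2 * k s) ∩ Ioi 0 = Ioi 0 := by
      refine inter_eq_right.2 fun s hs => ?_
      exact (mul_pos (pow_pos hs 2) (hkpos s)).ne'
    rw [this]; simp
  set I1 := ∫ s in Ioi (0 : ℝ), k s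
  set I2 := ∫ s in Ioi (0 : ℝ), s ^ 2 * k s
  obtain ⟨u, hu, hu2⟩ : ∃ u, 0 < u ∧ u * I1 < I2 :=
    ⟨I2 / (2 * I1), by positivity, by field_simp; linarith⟩
  refine ⟨-u, by linarith, ?_⟩
  have hint : ∫ s in Ioi (0 : ℝ), (slowness 0 1 s + (3 * u) * (s ^ 2 * k s)
      - (3 * u ^ 2) * k s) = ellipticIntegral 0 + 3 * u * I2 - 3 * u ^ 2 * I1 := by
    rw [integral_sub, integral_add, integral_const_mul, integral_const_mul]
    · rfl
    · exact (integrable_slowness 0 one_pos).integrableOn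
    · exact (hi2.const_mul _).integrableOn
    · exact ((integrable_slowness 0 one_pos).add (hi2.const_mul _)).integrableOn
    · exact (hi1.const_mul _).integrableOn
  have hle : ∫ s in Ioi (0 : ℝ), (slowness 0 1 s + (3 * u) * (s ^ 2 * k s)
      - (3 * u ^ 2) * k s) ≤ ellipticIntegral (-u) := by
    rw [ellipticIntegral_eq]
    refine setIntegral_mono (((integrable_slowness 0 one_pos).add (hi2.const_mul _)).sub
      (hi1.const_mul _)).integrableOn (integrable_slowness _ one_pos).integrableOn fun s => ?_
    have := one_div_sqrt_ge (radicand_pos 0 one_pos s) (radicand_pos (-u) one_pos s)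
    have e : radicand 0 1 s - radicand (-u) 1 s = 3 * u * s ^ 2 - 3 * u ^ 2 := by
      unfold radicand; ring
    rw [e] at this
    simp only [slowness, hk]
    linarith
  rw [hint] at hle
  nlinarith

theorem continuous_ellipticIntegral : Continuous ellipticIntegral := by
  refine continuous_iff_continuousAt.2 fun v => ?_
  exact (continuousAt_blowupTime (p := (v, 1)) one_pos).comp
    (f := fun v : ℝ => (v, (1 : ℝ))) (by fun_prop)

theorem exists_neg_isMax_ellipticIntegral :
    ∃ v < 0, ∀ u, ellipticIntegral u ≤ ellipticIntegral v := by
  obtain ⟨v, hv⟩ := exists_forall_le_of_tendsto_cocompact continuous_ellipticIntegral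
    (blowupTime_pos 0 one_pos) (tendsto_blowupTime_cocompact one_pos)
  obtain ⟨u, hu, hlt⟩ := exists_neg_ellipticIntegral_zero_lt
  refine ⟨v, not_le.1 fun h => ?_, hv⟩
  exact absurd ((hv u).trans (ellipticIntegral_le_zero h)) (not_le.2 hlt)

theorem isGreatest_C : IsGreatest (ellipticIntegral '' Iio 0) C := by
  obtain ⟨v, hv, hmax⟩ := exists_neg_isMax_ellipticIntegral
  have h : IsGreatest (ellipticIntegral '' Iio 0) (ellipticIntegral v) :=
    ⟨mem_image_of_mem _ hv, by rintro _ ⟨u, -, rfl⟩; exact hmax u⟩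
  rwa [C, h.csSup_eq]

theorem exists_ellipticIntegral_eq_C : ∃ v, ellipticIntegral v = C := by
  obtain ⟨v, -, hv⟩ := isGreatest_C.1
  exact ⟨v, hv⟩

theorem ellipticIntegral_le_C (u : ℝ) : ellipticIntegral u ≤ C := by
  obtain ⟨v, hv, hmax⟩ := exists_neg_isMax_ellipticIntegral
  exact (hmax u).trans (isGreatest_C.2 (mem_image_of_mem _ hv))

theorem C_pos : 0 < C := by
  obtain ⟨v, hv⟩ := exists_ellipticIntegral_eq_C
  exact hv ▸ blowupTime_pos v one_pos

theorem blowupTime_le {c : ℝ} (hc : 0 < c) (a : ℝ) : blowupTime a (c ^ 4) ≤ C / c := by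
  have h := blowupTime_scaling hc (a / c ^ 2)
  rw [mul_div_cancel₀ _ (by positivity)] at h
  rw [h]
  have := ellipticIntegral_le_C (a / c ^ 2)
  gcongr

/-! ### Uniqueness, local existence, gluing and maximal solutions -/

namespace IsSolution

variable {y z : ℝ → ℝ} {I J : Set ℝ}

theorem continuousOn (h : IsSolution y I) : ContinuousOn y I := fun x hx =>
  (h.hasDerivAt x hx).continuousAt.continuousWithinAt

theorem continuousOn_deriv (h : IsSolution y I) : ContinuousOn (deriv y) I := fun x hx =>
  (h.hasDerivAt_deriv x hx).continuousAt.continuousWithinAt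

/-- A function with a second derivative given by the equation is a solution. -/
theorem of_hasDerivAt {p : ℝ → ℝ} (hI : IsOpen I) (hI' : I.OrdConnected)
    (hy : ∀ x ∈ I, HasDerivAt y (p x) x) (hp : ∀ x ∈ I, HasDerivAt p (6 * y x ^ 2 - x) x) :
    IsSolution y I where
  isOpen := hI
  ordConnected := hI'
  hasDerivAt x hx := (hy x hx).differentiableAt.hasDerivAt
  hasDerivAt_deriv x hx := (hp x hx).congr_of_eventuallyEq <| by
    filter_upwards [hI.mem_nhds hx] with t ht using (hy t ht).deriv

/-- The equation depends only on the germ of the function. -/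
theorem of_forall_eventuallyEq (hI : IsOpen I) (hI' : I.OrdConnected)
    (h : ∀ x ∈ I, ∃ (z : ℝ → ℝ) (J : Set ℝ), IsSolution z J ∧ x ∈ J ∧ y =ᶠ[𝓝 x] z) :
    IsSolution y I where
  isOpen := hI
  ordConnected := hI'
  hasDerivAt x hx := by
    obtain ⟨z, J, hz, hxJ, hyz⟩ := h x hx
    exact ((hz.hasDerivAt x hxJ).congr_of_eventuallyEq hyz).differentiableAt.hasDerivAt
  hasDerivAt_deriv x hx := by
    obtain ⟨z, J, hz, hxJ, hyz⟩ := h x hx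
    rw [hyz.self_of_nhds]
    exact (hz.hasDerivAt_deriv x hxJ).congr_of_eventuallyEq hyz.deriv

/-- Both solutions are bounded on the compact interval between t and x. On the strip |y| ≤ R the
vector field is Lipschitz with constant 1 + 12R, so ODE uniqueness applies in either direction. -/
theorem apply_eq_apply (hy : IsSolution y I) (hz : IsSolution z J) {t x : ℝ}
    (htI : t ∈ I) (htJ : t ∈ J) (hxI : x ∈ I) (hxJ : x ∈ J)
    (h0 : y t = z t) (h1 : deriv y t = deriv z t) : y x = z x := by
  set v : ℝ → ℝ × ℝ → ℝ × ℝ := fun x q => (q.2, 6 * q.1 ^ 2 - x) with hv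
  have hsI : uIcc t x ⊆ I := hy.ordConnected.uIcc_subset htI hxI
  have hsJ : uIcc t x ⊆ J := hz.ordConnected.uIcc_subset htJ hxJ
  obtain ⟨R₁, hR₁⟩ := isCompact_uIcc.exists_bound_of_continuousOn (hy.continuousOn.mono hsI)
  obtain ⟨R₂, hR₂⟩ := isCompact_uIcc.exists_bound_of_continuousOn (hz.continuousOn.mono hsJ)
  set R := max R₁ R₂ with hR
  have hR0 : 0 ≤ R := ((norm_nonneg _).trans (hR₁ t left_mem_uIcc)).trans (le_max_left _ _)
  set K : NNReal := Real.toNNReal (1 + 12 * R) with hK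
  have hKc : (K : ℝ) = 1 + 12 * R := Real.coe_toNNReal _ (by positivity)
  set s : Set (ℝ × ℝ) := {q | |q.1| ≤ R} with hs
  have hlip : ∀ t, LipschitzOnWith K (v t) s := by
    intro t
    refine LipschitzOnWith.of_dist_le_mul fun q hq r hr => ?_
    have e1 : |q.1 - r.1| ≤ dist q r := by
      rw [Prod.dist_eq, Real.dist_eq]; exact le_max_left _ _
    have e2 : |q.2 - r.2| ≤ dist q r := by
      rw [Prod.dist_eq, Real.dist_eq, Real.dist_eq]; exact le_max_right _ _
    have hd : 0 ≤ dist q r := dist_nonneg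
    rw [hKc, Prod.dist_eq]
    refine max_le ?_ ?_
    · rw [Real.dist_eq]
      simp only [hv]
      nlinarith
    · rw [Real.dist_eq]
      simp only [hv]
      have : 6 * q.1 ^ 2 - t - (6 * r.1 ^ 2 - t) = 6 * (q.1 + r.1) * (q.1 - r.1) := by ring
      rw [this, abs_mul, abs_mul, abs_of_pos (by norm_num : (0 : ℝ) < 6)]
      have h3 : |q.1 + r.1| ≤ 2 * R := by
        have := abs_add_le q.1 r.1
        have hq' : |q.1| ≤ R := hq
        have hr' : |r.1| ≤ R := hr
        linarith
      calc 6 * |q.1 + r.1| * |q.1 - r.1| ≤ 6 * (2 * R) * dist q r := by gcongr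
        _ ≤ _ := by nlinarith
  have hyv : ∀ t ∈ I, HasDerivAt (fun t => (y t, deriv y t)) (v t (y t, deriv y t)) t :=
    fun t ht => (hy.hasDerivAt t ht).prodMk (hy.hasDerivAt_deriv t ht)
  have hzv : ∀ t ∈ J, HasDerivAt (fun t => (z t, deriv z t)) (v t (z t, deriv z t)) t :=
    fun t ht => (hz.hasDerivAt t ht).prodMk (hz.hasDerivAt_deriv t ht)
  have hys : ∀ τ ∈ uIcc t x, (y τ, deriv y τ) ∈ s := fun τ hτ =>
    (hR₁ τ hτ).trans (le_max_left _ _)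
  have hzs : ∀ τ ∈ uIcc t x, (z τ, deriv z τ) ∈ s := fun τ hτ =>
    (hR₂ τ hτ).trans (le_max_right _ _)
  have h01 : (y t, deriv y t) = (z t, deriv z t) := by rw [h0, h1]
  suffices h : (y x, deriv y x) = (z x, deriv z x) from congrArg Prod.fst h
  rcases le_total t x with htx | htx
  · rw [uIcc_of_le htx] at hsI hsJ hys hzs
    exact ODE_solution_unique_of_mem_Icc_right (s := fun _ => s) (fun t _ => hlip t)
      (fun τ hτ => (hyv τ (hsI hτ)).continuousAt.continuousWithinAt)
      (fun τ hτ => (hyv τ (hsI (Ico_subset_Icc_self hτ))).hasDerivWithinAt)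
      (fun τ hτ => hys τ (Ico_subset_Icc_self hτ))
      (fun τ hτ => (hzv τ (hsJ hτ)).continuousAt.continuousWithinAt)
      (fun τ hτ => (hzv τ (hsJ (Ico_subset_Icc_self hτ))).hasDerivWithinAt)
      (fun τ hτ => hzs τ (Ico_subset_Icc_self hτ)) h01 (right_mem_Icc.2 htx)
  · rw [uIcc_of_ge htx] at hsI hsJ hys hzs
    exact ODE_solution_unique_of_mem_Icc_left (s := fun _ => s) (fun t _ => hlip t)
      (fun τ hτ => (hyv τ (hsI hτ)).continuousAt.continuousWithinAt)
      (fun τ hτ => (hyv τ (hsI (Ioc_subset_Icc_self hτ))).hasDerivWithinAt)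
      (fun τ hτ => hys τ (Ioc_subset_Icc_self hτ))
      (fun τ hτ => (hzv τ (hsJ hτ)).continuousAt.continuousWithinAt)
      (fun τ hτ => (hzv τ (hsJ (Ioc_subset_Icc_self hτ))).hasDerivWithinAt)
      (fun τ hτ => hzs τ (Ioc_subset_Icc_self hτ)) h01 (left_mem_Icc.2 htx)

end IsSolution

/-- Near every point of the phase space the solutions exist for a uniform time. -/
theorem exists_uniform_local_solution (β Y P : ℝ) :
    ∃ r > (0 : ℝ), ∃ ε > (0 : ℝ), ∀ t a b : ℝ, |t - β| ≤ r → |a - Y| ≤ r → |b - P| ≤ r →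
      ∃ z : ℝ → ℝ, IsSolution z (Ioo (t - ε) (t + ε)) ∧ z t = a ∧ deriv z t = b := by
  -- Time becomes a phase coordinate, so that the existence time of the autonomous system is uniform
  -- in the starting time too.
  set f : ℝ × ℝ × ℝ → ℝ × ℝ × ℝ := fun q => (1, q.2.2, 6 * q.2.1 ^ 2 - q.1) with hf
  have hfc : ContDiffAt ℝ 1 f (β, Y, P) := by
    apply ContDiff.contDiffAt
    fun_prop
  obtain ⟨r, hr, ε, hε, h⟩ :=
    hfc.exists_forall_mem_closedBall_exists_eq_forall_mem_Ioo_hasDerivAt 0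
  refine ⟨r, hr, ε, hε, fun t a b ht ha hb => ?_⟩
  obtain ⟨α, hα0, hα⟩ := h (t, a, b) (by
    rw [Metric.mem_closedBall, Prod.dist_eq, Prod.dist_eq]
    exact max_le ht (max_le ha hb))
  have hshift : ∀ x ∈ Ioo (t - ε) (t + ε), x - t ∈ Ioo (0 - ε) (0 + ε) := fun x hx =>
    ⟨by linarith [hx.1], by linarith [hx.2]⟩
  have hβ : ∀ x ∈ Ioo (t - ε) (t + ε), HasDerivAt (fun x => α (x - t)) (f (α (x - t))) x :=
    fun x hx => (hα _ (hshift x hx)).comp_sub_const x t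
  have htm : t ∈ Ioo (t - ε) (t + ε) := ⟨by linarith, by linarith⟩
  have h1 : ∀ x ∈ Ioo (t - ε) (t + ε), HasDerivAt (fun x => (α (x - t)).1) 1 x :=
    fun x hx => (hβ x hx).fst
  have h2 : ∀ x ∈ Ioo (t - ε) (t + ε),
      HasDerivAt (fun x => (α (x - t)).2.1) (α (x - t)).2.2 x := fun x hx =>
    (hβ x hx).snd.fst
  have h3 : ∀ x ∈ Ioo (t - ε) (t + ε), HasDerivAt (fun x => (α (x - t)).2.2)
      (6 * (α (x - t)).2.1 ^ 2 - (α (x - t)).1) x := fun x hx =>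
    (hβ x hx).snd.snd
  have htime : ∀ x ∈ Ioo (t - ε) (t + ε), (α (x - t)).1 = x := by
    intro x hx
    have hd : ∀ x ∈ Ioo (t - ε) (t + ε), HasDerivAt (fun x => (α (x - t)).1 - x) 0 x :=
      fun x hx => by simpa using (h1 x hx).fun_sub (hasDerivAt_id' x)
    have := isOpen_Ioo.is_const_of_deriv_eq_zero isPreconnected_Ioo
      (fun x hx => (hd x hx).differentiableAt.differentiableWithinAt)
      (fun x hx => (hd x hx).deriv) hx htm
    simp [hα0] at this
    linarith
  refine ⟨fun x => (α (x - t)).2.1, IsSolution.of_hasDerivAt isOpen_Ioo ordConnected_Ioo h2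
    fun x hx => ?_, by simp [hα0], by rw [(h2 t htm).deriv]; simp [hα0]⟩
  have := h3 x hx
  rwa [htime x hx] at this

/-- Two solutions with a common initial value fit together. -/
theorem IsSolution.union {y z : ℝ → ℝ} {I J : Set ℝ} (hy : IsSolution y I) (hz : IsSolution z J)
    {t : ℝ} (htI : t ∈ I) (htJ : t ∈ J) (h0 : y t = z t) (h1 : deriv y t = deriv z t) :
    ∃ w, IsSolution w (I ∪ J) ∧ EqOn w y I := by
  classical
  refine ⟨fun x => if x ∈ I then y x else z x, ?_, fun x hx => by simp [hx]⟩
  refine .of_forall_eventuallyEq (hy.isOpen.union hz.isOpen) ?_ ?_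
  · exact (IsPreconnected.union t htI htJ hy.ordConnected.isPreconnected
      hz.ordConnected.isPreconnected).ordConnected
  · rintro x (hx | hx)
    · refine ⟨y, I, hy, hx, ?_⟩
      filter_upwards [hy.isOpen.mem_nhds hx] with τ hτ
      simp [hτ]
    · refine ⟨z, J, hz, hx, ?_⟩
      filter_upwards [hz.isOpen.mem_nhds hx] with τ hτ
      by_cases h : τ ∈ I
      · simpa [h] using hy.apply_eq_apply hz htI htJ h hτ h0 h1
      · simp [h]

/-- The interval is the union of all intervals carrying a solution with these data; uniqueness makes
these solutions agree on overlaps. -/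
theorem exists_isMaximalSolution (x₀ y₀ y₁ : ℝ) :
    ∃ (y : ℝ → ℝ) (I : Set ℝ), IsMaximalSolution y I ∧ x₀ ∈ I ∧ y x₀ = y₀ ∧ deriv y x₀ = y₁ := by
  classical
  set F : Set (Set ℝ) := {J | ∃ z, IsSolution z J ∧ x₀ ∈ J ∧ z x₀ = y₀ ∧ deriv z x₀ = y₁} with hF
  have hex : ∀ x ∈ ⋃₀ F, ∃ (z : ℝ → ℝ) (J : Set ℝ),
      (IsSolution z J ∧ x₀ ∈ J ∧ z x₀ = y₀ ∧ deriv z x₀ = y₁) ∧ x ∈ J := by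
    rintro x ⟨J, ⟨z, hz⟩, hx⟩
    exact ⟨z, J, hz, hx⟩
  choose! Z D hZD using hex
  set y : ℝ → ℝ := fun x => Z x x with hy
  have hyz : ∀ (z : ℝ → ℝ) (J : Set ℝ), IsSolution z J → x₀ ∈ J → z x₀ = y₀ →
      deriv z x₀ = y₁ → EqOn y z J := by
    intro z J hz hx h0 h1 x hxJ
    obtain ⟨⟨hs, hm, e0, e1⟩, hxD⟩ := hZD x ⟨J, ⟨z, hz, hx, h0, h1⟩, hxJ⟩
    exact hs.apply_eq_apply hz hm hx hxD hxJ (e0.trans h0.symm) (e1.trans h1.symm)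
  have hsol : IsSolution y (⋃₀ F) := by
    refine .of_forall_eventuallyEq (isOpen_sUnion ?_) ?_ ?_
    · rintro J ⟨z, hz, -⟩
      exact hz.isOpen
    · refine (isPreconnected_sUnion x₀ F ?_ ?_).ordConnected
      · rintro J ⟨z, hz, h, -⟩
        exact h
      · rintro J ⟨z, hz, -⟩
        exact hz.ordConnected.isPreconnected
    · rintro x ⟨J, ⟨z, hz, hx, h0, h1⟩, hxJ⟩
      exact ⟨z, J, hz, hxJ, (hyz z J hz hx h0 h1).eventuallyEq_of_mem (hz.isOpen.mem_nhds hxJ)⟩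
  obtain ⟨r, hr, ε, hε, hloc⟩ := exists_uniform_local_solution x₀ y₀ y₁
  obtain ⟨z, hz, h0, h1⟩ := hloc x₀ y₀ y₁ (by simpa using hr.le) (by simpa using hr.le)
    (by simpa using hr.le)
  have hm : x₀ ∈ Ioo (x₀ - ε) (x₀ + ε) := ⟨by linarith, by linarith⟩
  have heq := hyz z _ hz hm h0 h1
  have hev : y =ᶠ[𝓝 x₀] z := heq.eventuallyEq_of_mem (hz.isOpen.mem_nhds hm)
  have hx₀ : x₀ ∈ ⋃₀ F := ⟨_, ⟨z, hz, hm, h0, h1⟩, hm⟩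
  refine ⟨y, ⋃₀ F, ⟨hsol, ?_⟩, hx₀, (heq hm).trans h0, hev.deriv_eq.trans h1⟩
  intro w J hw hIJ hwy
  refine (subset_sUnion_of_mem ?_).antisymm hIJ
  have hev' : w =ᶠ[𝓝 x₀] y := hwy.eventuallyEq_of_mem (hsol.isOpen.mem_nhds hx₀)
  exact ⟨w, hw, hIJ hx₀, (hwy hx₀).trans ((heq hm).trans h0),
    hev'.deriv_eq.trans (hev.deriv_eq.trans h1)⟩

/-- A maximal solution that stays bounded up to `β` is defined at `β`. -/
theorem IsMaximalSolution.mem_of_bounded {y : ℝ → ℝ} {I : Set ℝ} (h : IsMaximalSolution y I)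
    {m β B : ℝ} (hmβ : m < β) (hI : Ico m β ⊆ I) (hy : ∀ t ∈ Ico m β, |y t| ≤ B)
    (hy' : ∀ t ∈ Ico m β, |deriv y t| ≤ B) : β ∈ I := by
  have hcomp : IsCompact (Icc (-B) B ×ˢ Icc (-B) B) := isCompact_Icc.prod isCompact_Icc
  have hev : ∀ᶠ t in 𝓝[<] β, (y t, deriv y t) ∈ Icc (-B) B ×ˢ Icc (-B) B := by
    filter_upwards [Ico_mem_nhdsLT hmβ] with t ht
    exact ⟨abs_le.1 (hy t ht), abs_le.1 (hy' t ht)⟩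
  -- The phase point has a cluster point as t ↑ β. Existence time is uniform near it, so a solution
  -- restarted close enough to β runs past β, and maximality forces β ∈ I.
  obtain ⟨⟨Y, P⟩, -, hcl⟩ := hcomp.exists_mapClusterPt (f := 𝓝[<] β)
    (u := fun t => (y t, deriv y t)) (le_principal_iff.2 hev)
  obtain ⟨r, hr, ε, hε, hloc⟩ := exists_uniform_local_solution β Y P
  have hfreq := hcl.frequently (Metric.closedBall_mem_nhds (Y, P) hr)
  have hnear : ∀ᶠ t in 𝓝[<] β, t ∈ Ico m β ∧ |t - β| ≤ r ∧ β < t + ε := by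
    refine (Filter.eventually_of_mem (Ico_mem_nhdsLT hmβ) fun _ h => h).and
      (nhdsWithin_le_nhds ?_)
    have h1 : ∀ᶠ t in 𝓝 β, |t - β| ≤ r := Metric.closedBall_mem_nhds β hr
    have h2 : ∀ᶠ t in 𝓝 β, β - ε < t := lt_mem_nhds (by linarith)
    filter_upwards [h1, h2] with t h1 h2
    exact ⟨h1, by linarith⟩
  obtain ⟨t, ht, htm, htr, hβt⟩ := (hfreq.and_eventually hnear).exists
  rw [Prod.dist_eq, max_le_iff] at ht
  obtain ⟨z, hz, h0, h1⟩ := hloc t (y t) (deriv y t) htr ht.1 ht.2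
  obtain ⟨w, hw, hwy⟩ := h.1.union hz (hI htm) ⟨by linarith, by linarith⟩ h0.symm h1.symm
  have := h.2 w _ hw subset_union_left hwy
  rw [← this]
  exact Or.inr ⟨by linarith [htm.2], hβt⟩

/-! ### Convexity on x ≤ 0, energy inequalities and comparison of times -/

namespace IsSolution

variable {y : ℝ → ℝ} {I : Set ℝ}

theorem strictMonoOn_deriv (h : IsSolution y I) {s : Set ℝ} (hs : s ⊆ I) (hs' : s.OrdConnected)
    (hneg : s ⊆ Iic 0) : StrictMonoOn (deriv y) s := by
  refine strictMonoOn_of_deriv_pos hs'.convex (h.continuousOn_deriv.mono hs) fun x hx => ?_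
  rw [(h.hasDerivAt_deriv x (hs (interior_subset hx))).deriv]
  have : x < 0 := by simpa using interior_mono hneg hx
  nlinarith [sq_nonneg (y x)]

variable {m t : ℝ}

theorem deriv_pos_of_lt (h : IsSolution y I) (hm : m ∈ I) (h0 : deriv y m = 0) (ht : t ∈ I)
    (hmt : m < t) (ht0 : t ≤ 0) : 0 < deriv y t := by
  rw [← h0]
  exact h.strictMonoOn_deriv (h.ordConnected.out hm ht) ordConnected_Icc
    (fun x hx => hx.2.trans ht0) (left_mem_Icc.2 hmt.le) (right_mem_Icc.2 hmt.le) hmt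

theorem lt_apply_of_lt (h : IsSolution y I) (hm : m ∈ I) (h0 : deriv y m = 0) (ht : t ∈ I)
    (hmt : m < t) (ht0 : t ≤ 0) : y m < y t := by
  have hsub := h.ordConnected.out hm ht
  refine strictMonoOn_of_deriv_pos (convex_Icc m t) (h.continuousOn.mono hsub) (fun x hx => ?_)
    (left_mem_Icc.2 hmt.le) (right_mem_Icc.2 hmt.le) hmt
  rw [interior_Icc] at hx
  exact h.deriv_pos_of_lt hm h0 (hsub (Ioo_subset_Icc_self hx)) hx.1 (hx.2.le.trans ht0)

theorem deriv_nonneg_of_le (h : IsSolution y I) (hm : m ∈ I) (h0 : deriv y m = 0) (ht : t ∈ I)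
    (hmt : m ≤ t) (ht0 : t ≤ 0) : 0 ≤ deriv y t := by
  rcases hmt.eq_or_lt with rfl | hmt
  · exact h0.ge
  · exact (h.deriv_pos_of_lt hm h0 ht hmt ht0).le

theorem le_apply_of_le (h : IsSolution y I) (hm : m ∈ I) (h0 : deriv y m = 0) (ht : t ∈ I)
    (hmt : m ≤ t) (ht0 : t ≤ 0) : y m ≤ y t := by
  rcases hmt.eq_or_lt with rfl | hmt
  · exact le_rfl
  · exact (h.lt_apply_of_lt hm h0 ht hmt ht0).le

/-- Convexity: the slope of a chord is at most the slope at its right end. -/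
theorem sub_le_mul_deriv (h : IsSolution y I) (hm : m ∈ I) (ht : t ∈ I)
    (hmt : m ≤ t) (ht0 : t ≤ 0) : y t - y m ≤ (t - m) * deriv y t := by
  rcases hmt.eq_or_lt with rfl | hmt
  · simp
  have hsub := h.ordConnected.out hm ht
  obtain ⟨x, hx, hxe⟩ := exists_hasDerivAt_eq_slope y (deriv y) hmt (h.continuousOn.mono hsub)
    fun x hx => h.hasDerivAt x (hsub (Ioo_subset_Icc_self hx))
  have hle := (h.strictMonoOn_deriv hsub ordConnected_Icc (fun x hx => hx.2.trans ht0)).monotoneOn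
    (Ioo_subset_Icc_self hx) (right_mem_Icc.2 hmt.le) hx.2.le
  rw [hxe, div_le_iff₀ (by linarith)] at hle
  linarith

/-- With the force frozen at its value -p at the right end, the energy defect has derivative 2y'(p -
x) ≥ 0 and vanishes at m. -/
theorem energy_ge (h : IsSolution y I) (hm : m ∈ I) (h0 : deriv y m = 0) {p : ℝ} (hp : p ∈ I)
    (hmt : m ≤ t) (htp : t ≤ p) (hp0 : p ≤ 0) :
    4 * (y t ^ 3 - y m ^ 3) + 2 * -p * (y t - y m) ≤ deriv y t ^ 2 := by
  have hsub := h.ordConnected.out hm hp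
  have hd : ∀ x ∈ Icc m p, HasDerivAt
      (fun x => deriv y x ^ 2 - (4 * (y x ^ 3 - y m ^ 3) + 2 * -p * (y x - y m)))
      (2 * deriv y x * (p - x)) x := fun x hx => by
    have hy := h.hasDerivAt x (hsub hx)
    have hy' := h.hasDerivAt_deriv x (hsub hx)
    refine ((hy'.fun_pow 2).fun_sub ((((hy.fun_pow 3).sub_const (y m ^ 3)).const_mul 4).fun_add
      ((hy.sub_const (y m)).const_mul (2 * -p)))).congr_deriv ?_
    push_cast; ring
  have hmono : MonotoneOn
      (fun x => deriv y x ^ 2 - (4 * (y x ^ 3 - y m ^ 3) + 2 * -p * (y x - y m))) (Icc m p) := by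
    refine monotoneOn_of_deriv_nonneg (convex_Icc m p)
      (fun x hx => (hd x hx).continuousAt.continuousWithinAt)
      (fun x hx => (hd x (interior_subset hx)).differentiableAt.differentiableWithinAt)
      fun x hx => ?_
    have hx := interior_subset hx
    rw [(hd x hx).deriv]
    have := h.deriv_nonneg_of_le hm h0 (hsub hx) hx.1 (hx.2.trans hp0)
    have : 0 ≤ p - x := by linarith [hx.2]
    positivity
  have := hmono ⟨le_rfl, hmt.trans htp⟩ ⟨hmt, htp⟩ hmt
  simp only [h0] at this
  linarith

/-- The force averaged over time, -m - (t - m)/2, suffices: the defect has derivative y - y(m) - (x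
- m)y', which convexity makes nonpositive. This is what makes the delay of blow-up quantitative. -/
theorem energy_le (h : IsSolution y I) (hm : m ∈ I) (h0 : deriv y m = 0) (ht : t ∈ I)
    (hmt : m ≤ t) (ht0 : t ≤ 0) :
    deriv y t ^ 2 ≤ 4 * (y t ^ 3 - y m ^ 3) + 2 * (-m - (t - m) / 2) * (y t - y m) := by
  have hsub := h.ordConnected.out hm ht
  have hd : ∀ x ∈ Icc m t, HasDerivAt
      (fun x => deriv y x ^ 2 - (4 * (y x ^ 3 - y m ^ 3) + 2 * (-m - (x - m) / 2) * (y x - y m)))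
      (y x - y m - (x - m) * deriv y x) x := fun x hx => by
    have hy := h.hasDerivAt x (hsub hx)
    have hy' := h.hasDerivAt_deriv x (hsub hx)
    have hc : HasDerivAt (fun x => 2 * (-m - (x - m) / 2)) (2 * (-(1 / 2))) x :=
      ((((hasDerivAt_id' x).sub_const m).div_const 2).const_sub (-m)).const_mul 2
    refine ((hy'.fun_pow 2).fun_sub ((((hy.fun_pow 3).sub_const (y m ^ 3)).const_mul 4).fun_add
      (hc.fun_mul (hy.sub_const (y m))))).congr_deriv ?_
    push_cast; ring
  have hanti : AntitoneOn
      (fun x => deriv y x ^ 2 - (4 * (y x ^ 3 - y m ^ 3) + 2 * (-m - (x - m) / 2) * (y x - y m)))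
      (Icc m t) := by
    refine antitoneOn_of_deriv_nonpos (convex_Icc m t)
      (fun x hx => (hd x hx).continuousAt.continuousWithinAt)
      (fun x hx => (hd x (interior_subset hx)).differentiableAt.differentiableWithinAt)
      fun x hx => ?_
    have hx := interior_subset hx
    rw [(hd x hx).deriv]
    linarith [h.sub_le_mul_deriv hm (hsub hx) hx.1 (hx.2.trans ht0)]
  have := hanti ⟨le_rfl, hmt⟩ ⟨hmt, le_rfl⟩ hmt
  simp only [h0] at this
  linarith

theorem force_eq_radicand {a b : ℝ} (c : ℝ) (hab : a ≤ b) :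
    4 * (b ^ 3 - a ^ 3) + 2 * c * (b - a) = (2 * √(b - a)) ^ 2 * radicand a c √(b - a) := by
  obtain ⟨s, hs, rfl⟩ : ∃ s, 0 ≤ s ∧ b = a + s ^ 2 :=
    ⟨√(b - a), Real.sqrt_nonneg _, by rw [Real.sq_sqrt (by linarith)]; ring⟩
  rw [add_sub_cancel_left, Real.sqrt_sq hs]
  unfold radicand
  ring

theorem hasDerivAt_riseTime_sqrt (h : IsSolution y I) (hm : m ∈ I) (h0 : deriv y m = 0)
    (ht : t ∈ I) (hmt : m < t) (ht0 : t ≤ 0) {c : ℝ} (hc : 0 < c) :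
    HasDerivAt (fun t => riseTime (y m) c √(y t - y m))
      (deriv y t / √(4 * (y t ^ 3 - y m ^ 3) + 2 * c * (y t - y m))) t := by
  have hlt := h.lt_apply_of_lt hm h0 ht hmt ht0
  have hs : 0 < √(y t - y m) := Real.sqrt_pos.2 (by linarith)
  have hR := Real.sqrt_pos.2 (radicand_pos (y m) hc √(y t - y m))
  have := (hasDerivAt_riseTime (y m) hc √(y t - y m)).comp t
    (((h.hasDerivAt t ht).sub_const (y m)).sqrt (by linarith))
  refine this.congr_deriv ?_
  rw [force_eq_radicand c hlt.le, Real.sqrt_mul (by positivity), Real.sqrt_sq (by positivity),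
    slowness]
  field_simp

theorem continuousOn_riseTime_sqrt (h : IsSolution y I) (a : ℝ) {c : ℝ} (hc : 0 < c) :
    ContinuousOn (fun t => riseTime a c √(y t - a)) I :=
  (continuous_iff_continuousAt.2 fun s =>
    (hasDerivAt_riseTime a hc s).continuousAt).comp_continuousOn
    (h.continuousOn.sub continuousOn_const).sqrt

theorem sub_le_riseTime (h : IsSolution y I) (hm : m ∈ I) (h0 : deriv y m = 0) {u v c : ℝ}
    (hv : v ∈ I) (hmu : m ≤ u) (huv : u ≤ v) (hv0 : v ≤ 0) (hc : 0 < c)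
    (hE : ∀ t ∈ Ioo u v, 4 * (y t ^ 3 - y m ^ 3) + 2 * c * (y t - y m) ≤ deriv y t ^ 2) :
    v - u ≤ riseTime (y m) c √(y v - y m) - riseTime (y m) c √(y u - y m) := by
  have hsub : Icc u v ⊆ I := (Icc_subset_Icc_left hmu).trans (h.ordConnected.out hm hv)
  have hd : ∀ t ∈ Ioo u v, HasDerivAt (fun t => riseTime (y m) c √(y t - y m) - t)
      (deriv y t / √(4 * (y t ^ 3 - y m ^ 3) + 2 * c * (y t - y m)) - 1) t := fun t ht =>
    (h.hasDerivAt_riseTime_sqrt hm h0 (hsub (Ioo_subset_Icc_self ht)) (hmu.trans_lt ht.1)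
      (ht.2.le.trans hv0) hc).sub (hasDerivAt_id' t)
  have hmono : MonotoneOn (fun t => riseTime (y m) c √(y t - y m) - t) (Icc u v) := by
    refine monotoneOn_of_deriv_nonneg (convex_Icc u v)
      (((h.continuousOn_riseTime_sqrt (y m) hc).mono hsub).sub continuousOn_id) ?_ ?_
    all_goals rw [interior_Icc]
    · exact fun t ht => (hd t ht).differentiableAt.differentiableWithinAt
    intro t ht
    have htI := hsub (Ioo_subset_Icc_self ht)
    have hmt := hmu.trans_lt ht.1
    have ht0 := ht.2.le.trans hv0
    have hlt := h.lt_apply_of_lt hm h0 htI hmt ht0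
    have hpos := h.deriv_pos_of_lt hm h0 htI hmt ht0
    have hF : 0 < 4 * (y t ^ 3 - y m ^ 3) + 2 * c * (y t - y m) := by
      rw [force_eq_radicand c hlt.le]
      have := radicand_pos (y m) hc √(y t - y m)
      have : 0 < √(y t - y m) := Real.sqrt_pos.2 (by linarith)
      positivity
    rw [(hd t ht).deriv, sub_nonneg, le_div_iff₀ (Real.sqrt_pos.2 hF), one_mul]
    exact Real.sqrt_le_iff.2 ⟨hpos.le, hE t ht⟩
  have := hmono (left_mem_Icc.2 huv) (right_mem_Icc.2 huv) huv
  simp only at this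
  linarith

theorem riseTime_le_sub (h : IsSolution y I) (hm : m ∈ I) (h0 : deriv y m = 0) {u v c : ℝ}
    (hv : v ∈ I) (hmu : m ≤ u) (huv : u ≤ v) (hv0 : v ≤ 0) (hc : 0 < c)
    (hE : ∀ t ∈ Ioo u v, deriv y t ^ 2 ≤ 4 * (y t ^ 3 - y m ^ 3) + 2 * c * (y t - y m)) :
    riseTime (y m) c √(y v - y m) - riseTime (y m) c √(y u - y m) ≤ v - u := by
  have hsub : Icc u v ⊆ I := (Icc_subset_Icc_left hmu).trans (h.ordConnected.out hm hv)
  have hd : ∀ t ∈ Ioo u v, HasDerivAt (fun t => riseTime (y m) c √(y t - y m) - t)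
      (deriv y t / √(4 * (y t ^ 3 - y m ^ 3) + 2 * c * (y t - y m)) - 1) t := fun t ht =>
    (h.hasDerivAt_riseTime_sqrt hm h0 (hsub (Ioo_subset_Icc_self ht)) (hmu.trans_lt ht.1)
      (ht.2.le.trans hv0) hc).sub (hasDerivAt_id' t)
  have hanti : AntitoneOn (fun t => riseTime (y m) c √(y t - y m) - t) (Icc u v) := by
    refine antitoneOn_of_deriv_nonpos (convex_Icc u v)
      (((h.continuousOn_riseTime_sqrt (y m) hc).mono hsub).sub continuousOn_id) ?_ ?_
    all_goals rw [interior_Icc]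
    · exact fun t ht => (hd t ht).differentiableAt.differentiableWithinAt
    intro t ht
    rw [(hd t ht).deriv, sub_nonpos]
    exact div_le_one_of_le₀ (Real.le_sqrt_of_sq_le (hE t ht)) (Real.sqrt_nonneg _)
  have := hanti (left_mem_Icc.2 huv) (right_mem_Icc.2 huv) huv
  simp only at this
  linarith

end IsSolution

/-! ### Lower bound for the positions of minima -/

theorem exists_isSolution_of_mem_minPoints {x₀ m : ℝ} (hm : m ∈ minPoints x₀) (hlt : m < x₀) :
    ∃ (y : ℝ → ℝ) (I : Set ℝ), IsSolution y I ∧ m ∈ I ∧ x₀ ∈ I ∧ deriv y m = 0 := by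
  obtain ⟨y₀, y₁, -, y, I, hmax, hx₀, -, -, hmI, hmin⟩ := hm
  refine ⟨y, I, hmax.1, hmI.1, hx₀, ?_⟩
  have hnhds : I ∩ Iic x₀ ∈ 𝓝 m := inter_mem (hmax.1.isOpen.mem_nhds hmI.1) (Iic_mem_nhds hlt)
  exact (hmin.isLocalMin hnhds).deriv_eq_zero

theorem le_of_mem_minPoints {x₀ m : ℝ} (hm : m ∈ minPoints x₀) : m ≤ x₀ := by
  obtain ⟨_, _, -, _, _, -, -, -, -, hmI, -⟩ := hm
  exact hmI.2

/-- The positions of the minima of the solutions that exist up to `-c ^ 4` stay uniformly to the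
right of `-c ^ 4 - C / c`. -/
theorem exists_lt_forall_le_of_deriv_eq_zero {c : ℝ} (hc : 0 < c) :
    ∃ b, -c ^ 4 - C / c < b ∧ b ≤ -c ^ 4 ∧ ∀ (y : ℝ → ℝ) (I : Set ℝ) (m : ℝ), IsSolution y I →
      m ∈ I → -c ^ 4 ∈ I → deriv y m = 0 → b ≤ m := by
  set T := C / c with hT
  have hTpos : 0 < T := div_pos C_pos hc
  have hc4 : 0 < c ^ 4 := by positivity
  -- Minima right of -c⁴ - T/2 are harmless. For the others -d lies in between, and at least T/4 of
  -- time is spent under a force ≥ d > c⁴.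
  set d := c ^ 4 + T / 4 with hd
  have hd0 : 0 < d := by positivity
  have hcd : c ^ 4 < d := by linarith
  have hr : 0 < √(c ^ 4 / 2) := Real.sqrt_pos.2 (by positivity)
  -- By `riseTime_le_mul`, s rises at least this far in time T/4, whatever a is.
  set δ := T / 4 * √(c ^ 4 / 2) with hδ
  have hδ0 : 0 < δ := by positivity
  set f : ℝ → ℝ := fun a => blowupTime a (c ^ 4) - riseTime a (c ^ 4) δ + riseTime a d δ with hf
  have hfc : Continuous f := by
    refine continuous_iff_continuousAt.2 fun a => ?_
    refine ContinuousAt.add (ContinuousAt.sub ?_ ?_) ?_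
    · exact (continuousAt_blowupTime (p := (a, c ^ 4)) hc4).comp
        (f := fun a : ℝ => (a, c ^ 4)) (by fun_prop)
    · exact (continuousAt_riseTime hδ0.le (p := (a, c ^ 4)) hc4).comp
        (f := fun a : ℝ => (a, c ^ 4)) (by fun_prop)
    · exact (continuousAt_riseTime hδ0.le (p := (a, d)) hd0).comp
        (f := fun a : ℝ => (a, d)) (by fun_prop)
  have hflim : Tendsto f (cocompact ℝ) (𝓝 0) := by
    simpa using ((tendsto_blowupTime_cocompact hc4).sub
      (tendsto_riseTime_cocompact hc4 hδ0.le)).add (tendsto_riseTime_cocompact hd0 hδ0.le)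
  have hf0 : 0 < f 0 := by
    have h1 := riseTime_lt_blowupTime 0 hc4 δ
    have h2 := strictMono_riseTime 0 hd0 hδ0
    simp only [riseTime_zero] at h2
    simp only [hf]; linarith
  -- Since f attains its maximum, the pointwise inequality f < T becomes a gap uniform in the
  -- minimum value.
  obtain ⟨a, ha⟩ := exists_forall_le_of_tendsto_cocompact hfc hf0 hflim
  have hfa : f a < T := by
    have h1 := strictMono_riseTime_sub a hc4 hcd hδ0
    have h2 := blowupTime_le hc a
    simp only [riseTime_zero] at h1
    simp only [hf]; linarith
  refine ⟨min (-c ^ 4 - T / 2) (-c ^ 4 - f a), lt_min (by linarith) (by linarith),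
    (min_le_left _ _).trans (by linarith), fun y I m hy hm hx h0 => ?_⟩
  rcases le_or_gt (-c ^ 4 - T / 2) m with hmq | hmq
  · exact (min_le_left _ _).trans hmq
  refine (min_le_right _ _).trans ?_
  have hp : -d ∈ I := hy.ordConnected.out hm hx ⟨by linarith, by linarith⟩
  have hEx : ∀ t, m ≤ t → t ≤ -c ^ 4 →
      4 * (y t ^ 3 - y m ^ 3) + 2 * c ^ 4 * (y t - y m) ≤ deriv y t ^ 2 := fun t h1 h2 => by
    simpa using hy.energy_ge hm h0 hx h1 h2 (by linarith)
  have hEp : ∀ t, m ≤ t → t ≤ -d →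
      4 * (y t ^ 3 - y m ^ 3) + 2 * d * (y t - y m) ≤ deriv y t ^ 2 := fun t h1 h2 => by
    simpa using hy.energy_ge hm h0 hp h1 h2 (by linarith)
  have h1 := hy.sub_le_riseTime hm h0 hp le_rfl (by linarith) (by linarith) hd0
    fun t ht => hEp t ht.1.le ht.2.le
  have h2 := hy.sub_le_riseTime hm h0 hx (u := -d) (by linarith) (by linarith) (by linarith) hc4
    fun t ht => hEx t (by linarith [ht.1]) ht.2.le
  have h3 := riseTime_lt_blowupTime (y m) hc4 √(y (-c ^ 4) - y m)
  set s := √(y (-d) - y m) with hs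
  simp only [sub_self, Real.sqrt_zero, riseTime_zero, sub_zero] at h1
  have hδs : δ ≤ s := by
    have h4 := riseTime_antitone (y m) hc4 hcd.le (Real.sqrt_nonneg (y (-d) - y m))
    have h5 := riseTime_le_mul (y m) hc4 (Real.sqrt_nonneg (y (-d) - y m))
    rw [← hs] at h4 h5
    have h6 : T / 4 ≤ s / √(c ^ 4 / 2) := by linarith
    rwa [le_div_iff₀ hr] at h6
  have h7 := (strictMono_riseTime_sub (y m) hc4 hcd).monotone hδs
  have h8 := ha (y m)
  simp only [hf] at h7 h8 ⊢
  linarith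

theorem exists_lt_forall_mem_minPoints_le {c : ℝ} (hc : 0 < c) :
    ∃ b, -c ^ 4 - C / c < b ∧ ∀ m ∈ minPoints (-c ^ 4), b ≤ m := by
  obtain ⟨b, hb, hb', h⟩ := exists_lt_forall_le_of_deriv_eq_zero hc
  refine ⟨b, hb, fun m hm => ?_⟩
  rcases (le_of_mem_minPoints hm).eq_or_lt with rfl | hlt
  · exact hb'
  · obtain ⟨y, I, hy, hmI, hx, h0⟩ := exists_isSolution_of_mem_minPoints hm hlt
    exact h y I m hy hmI hx h0

theorem bddBelow_minPoints {x₀ : ℝ} (hx₀ : x₀ ≤ 0) : BddBelow (minPoints x₀) := by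
  -- The point -(1 - x₀)⁴ is strictly left of x₀ and corresponds to c > 0 even for x₀ = 0.
  obtain ⟨b, -, hb', h⟩ := exists_lt_forall_le_of_deriv_eq_zero (c := 1 - x₀) (by linarith)
  have hlt : -(1 - x₀) ^ 4 < x₀ := by nlinarith [sq_nonneg (1 - x₀), sq_nonneg ((1 - x₀) ^ 2 - 1)]
  refine ⟨b, fun m hm => ?_⟩
  rcases le_or_gt (-(1 - x₀) ^ 4) m with hle | hgt
  · exact hb'.trans hle
  · obtain ⟨y, I, hy, hmI, hx, h0⟩ := exists_isSolution_of_mem_minPoints hm (hgt.trans hlt)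
    exact h y I m hy hmI (hy.ordConnected.out hmI hx ⟨hgt.le, hlt.le⟩) h0

/-! ### Construction of solutions with a minimum left of -η⁴ -/

/-- A maximal solution with a priori bounds up to `x₀` is defined at `x₀`. -/
theorem IsMaximalSolution.mem_of_apriori {y : ℝ → ℝ} {I : Set ℝ} (h : IsMaximalSolution y I)
    {m x₀ B : ℝ} (hm : m ∈ I) (hmx : m ≤ x₀)
    (hB : ∀ t ∈ I, m ≤ t → t ≤ x₀ → |y t| ≤ B ∧ |deriv y t| ≤ B) : x₀ ∈ I := by
  by_contra hx
  have hub : ∀ t ∈ I, t < x₀ := fun t ht => by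
    by_contra! hxt
    exact hx (h.1.ordConnected.out hm ht ⟨hmx, hxt⟩)
  have hbdd : BddAbove I := ⟨x₀, fun t ht => (hub t ht).le⟩
  set β := sSup I with hβ
  have hβx : β ≤ x₀ := csSup_le ⟨m, hm⟩ fun t ht => (hub t ht).le
  have hnot : β ∉ I := fun hβI => by
    obtain ⟨ε, hε, hball⟩ := Metric.isOpen_iff.1 h.1.isOpen β hβI
    have hmem : β + ε / 2 ∈ I := hball (by
      rw [Metric.mem_ball, Real.dist_eq, add_sub_cancel_left, abs_of_pos (by positivity)]
      linarith)
    linarith [le_csSup hbdd hmem]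
  have hmβ : m < β := (le_csSup hbdd hm).lt_of_ne fun e => hnot (by rwa [hβ, ← e])
  have hsub : Ico m β ⊆ I := fun t ht => by
    obtain ⟨u, hu, htu⟩ := exists_lt_of_lt_csSup ⟨m, hm⟩ ht.2
    exact h.1.ordConnected.out hm hu ⟨ht.1, htu.le⟩
  exact hnot (h.mem_of_bounded hmβ hsub
    (fun t ht => (hB t (hsub ht) ht.1 (ht.2.le.trans hβx)).1)
    fun t ht => (hB t (hsub ht) ht.1 (ht.2.le.trans hβx)).2)

theorem mem_minPoints_of_deriv_eq_zero {y : ℝ → ℝ} {I : Set ℝ} (h : IsMaximalSolution y I)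
    {m x₀ : ℝ} (hm : m ∈ I) (hx : x₀ ∈ I) (h0 : deriv y m = 0) (hmx : m ≤ x₀) (hx₀ : x₀ ≤ 0) :
    m ∈ minPoints x₀ := by
  refine ⟨y x₀, deriv y x₀, h.1.deriv_nonneg_of_le hm h0 hx hmx hx₀, y, I, h, hx, rfl, rfl,
    ⟨hm, hmx⟩, fun t ht => ?_⟩
  rcases le_total m t with hmt | htm
  · exact h.1.le_apply_of_le hm h0 ht.1 hmt (ht.2.trans hx₀)
  · have hsub := h.1.ordConnected.out ht.1 hm
    refine antitoneOn_of_deriv_nonpos (convex_Icc t m) (h.1.continuousOn.mono hsub)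
      (fun x hx => (h.1.hasDerivAt x
        (hsub (interior_subset hx))).differentiableAt.differentiableWithinAt)
      (fun x hx => ?_) (left_mem_Icc.2 htm) (right_mem_Icc.2 htm) htm
    rw [← h0]
    exact (h.1.strictMonoOn_deriv hsub ordConnected_Icc
      (fun x hx => hx.2.trans (hmx.trans hx₀))).monotoneOn (interior_subset hx)
      (right_mem_Icc.2 htm) (interior_subset hx).2

/-- If the time in which a rising solution with force `M` up to height `a + 1` and force `M - κ`
from then on blows up exceeds the distance from `-M` to `x₀`, then a solution with minimum `a` at
`-M` exists up to `x₀`. -/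
theorem neg_mem_minPoints {a M κ x₀ : ℝ} (hκ : 0 < κ) (hκM : κ < M) (hMx : -M ≤ x₀)
    (hx₀ : x₀ ≤ 0) (hrise : 2 * κ < riseTime a M 1)
    (hblow : x₀ + M < blowupTime a (M - κ) - riseTime a (M - κ) 1 + riseTime a M 1) :
    -M ∈ minPoints x₀ := by
  obtain ⟨y, I, hmax, hm, rfl, h0⟩ := exists_isMaximalSolution (-M) a 0
  set m := -M with hmM
  have hM : 0 < M := hκ.trans hκM
  have hMκ : 0 < M - κ := by linarith
  have hy := hmax.1
  obtain ⟨S, hS, hS1⟩ := (((tendsto_riseTime (y m) hMκ).eventually (lt_mem_nhds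
    (show x₀ + M + riseTime (y m) (M - κ) 1 - riseTime (y m) M 1 < blowupTime (y m) (M - κ) by
      linarith))).and (eventually_ge_atTop 1)).exists
  have hE : ∀ t ∈ I, m ≤ t → t ≤ x₀ →
      deriv y t ^ 2 ≤ 4 * (y t ^ 3 - y m ^ 3) + 2 * M * (y t - y m) := fun t ht h1 h2 => by
    have e1 := hy.energy_le hm h0 ht h1 (h2.trans hx₀)
    have e2 := hy.le_apply_of_le hm h0 ht h1 (h2.trans hx₀)
    have : (t - m) / 2 * (y t - y m) ≥ 0 := mul_nonneg (by linarith) (by linarith)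
    nlinarith
  -- The averaged force M - (t - m)/2 has dropped to M - κ after time 2κ; `hrise` ensures that s is
  -- still below 1 then.
  have hE' : ∀ t ∈ I, m + 2 * κ ≤ t → t ≤ x₀ →
      deriv y t ^ 2 ≤ 4 * (y t ^ 3 - y m ^ 3) + 2 * (M - κ) * (y t - y m) := fun t ht h1 h2 => by
    have e1 := hy.energy_le hm h0 ht (by linarith) (h2.trans hx₀)
    have e2 := hy.le_apply_of_le hm h0 ht (by linarith) (h2.trans hx₀)
    have : ((t - m) / 2 - κ) * (y t - y m) ≥ 0 := mul_nonneg (by linarith) (by linarith)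
    nlinarith
  have hfirst : ∀ t ∈ I, m ≤ t → t ≤ x₀ → riseTime (y m) M √(y t - y m) ≤ t - m :=
    fun t ht h1 h2 => by
      have hsub := hy.ordConnected.out hm ht
      simpa using hy.riseTime_le_sub hm h0 ht le_rfl h1 (h2.trans hx₀) hM fun τ hτ =>
        hE τ (hsub (Ioo_subset_Icc_self hτ)) hτ.1.le (hτ.2.le.trans h2)
  have hlow : ∀ t ∈ I, m ≤ t → t ≤ x₀ → t ≤ m + 2 * κ → √(y t - y m) < 1 :=
    fun t ht h1 h2 h3 => (strictMono_riseTime (y m) hM).lt_iff_lt.1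
      ((hfirst t ht h1 h2).trans_lt (by linarith))
  have hs : ∀ t ∈ I, m ≤ t → t ≤ x₀ → √(y t - y m) ≤ S := fun t ht h1 h2 => by
    rcases le_or_gt t (m + 2 * κ) with h3 | h3
    · exact (hlow t ht h1 h2 h3).le.trans hS1
    have hsub := hy.ordConnected.out hm ht
    have hp : m + 2 * κ ∈ I := hsub ⟨by linarith, h3.le⟩
    have e1 := hlow _ hp (by linarith) (by linarith) le_rfl
    have e2 := hfirst _ hp (by linarith) (by linarith)
    have e3 := hy.riseTime_le_sub hm h0 ht (u := m + 2 * κ) (by linarith) h3.le (h2.trans hx₀) hMκ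
      fun τ hτ => hE' τ (hsub ⟨by linarith [hτ.1], hτ.2.le⟩) hτ.1.le (hτ.2.le.trans h2)
    -- The delay grows with the height of the switch, so switching forces at the true height, below
    -- 1, costs no more than switching at s = 1.
    have e4 := (strictMono_riseTime_sub (y m) hMκ (by linarith : M - κ < M)).monotone e1.le
    refine (strictMono_riseTime (y m) hMκ).le_iff_le.1 ?_
    linarith
  set Y := |y m| + S ^ 2 with hY
  set Z := 8 * Y ^ 3 + 4 * M * Y with hZ
  have hx : x₀ ∈ I := hmax.mem_of_apriori (B := max Y √Z) hm hMx fun t ht h1 h2 => by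
    have e1 := hy.le_apply_of_le hm h0 ht h1 (h2.trans hx₀)
    have e2 := (Real.sqrt_le_left (by linarith)).1 (hs t ht h1 h2)
    have hY0 : |y m| ≤ Y := by have := sq_nonneg S; linarith
    have hyt : |y t| ≤ Y :=
      abs_le.2 ⟨by linarith [neg_abs_le (y m)], by linarith [le_abs_self (y m)]⟩
    refine ⟨hyt.trans (le_max_left _ _), (Real.abs_le_sqrt ?_).trans (le_max_right _ _)⟩
    refine (hE t ht h1 h2).trans ?_
    have c1 : y t ^ 3 ≤ Y ^ 3 := (le_abs_self _).trans (by rw [abs_pow]; gcongr)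
    have c2 : -(y m ^ 3) ≤ Y ^ 3 := (neg_le_abs _).trans (by rw [abs_pow]; gcongr)
    have c3 : y t - y m ≤ 2 * Y := by
      linarith [(abs_le.1 hyt).2, (abs_le.1 hY0).1]
    have c4 : 2 * M * (y t - y m) ≤ 2 * M * (2 * Y) := by gcongr
    rw [hZ]; linarith
  exact mem_minPoints_of_deriv_eq_zero hmax hm hx h0 hMx hx₀

/-- Lowering the force after the start delays the blow-up. -/
theorem blowupTime_lt_add {c d : ℝ} (a : ℝ) (hc : 0 < c) (hcd : c < d) (s : ℝ) :
    blowupTime a d < blowupTime a c - riseTime a c s + riseTime a d s := by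
  have hmono := strictMono_riseTime_sub a hc hcd
  have hlim := (tendsto_riseTime a hc).sub (tendsto_riseTime a (hc.trans hcd))
  have h1 := hmono (lt_add_one s)
  have h2 := hmono.monotone.ge_of_tendsto hlim (s + 1)
  simp only at h1 h2
  linarith

theorem eventually_lt_delayed_blowupTime {a M κ T : ℝ} (hκM : κ < M) (hM : 0 < M)
    (hT : T < blowupTime a (M - κ) - riseTime a (M - κ) 1 + riseTime a M 1) :
    ∀ᶠ ε in 𝓝 (0 : ℝ), T + ε <
      blowupTime a (M + ε - κ) - riseTime a (M + ε - κ) 1 + riseTime a (M + ε) 1 := by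
  have h1 : Tendsto (fun ε : ℝ => (a, M + ε - κ)) (𝓝 0) (𝓝 (a, M - κ)) := by
    have : Continuous fun ε : ℝ => (a, M + ε - κ) := by fun_prop
    simpa using this.tendsto 0
  have h2 : Tendsto (fun ε : ℝ => (a, M + ε)) (𝓝 0) (𝓝 (a, M)) := by
    have : Continuous fun ε : ℝ => (a, M + ε) := by fun_prop
    simpa using this.tendsto 0
  have h3 : Tendsto (fun ε : ℝ => T + ε) (𝓝 0) (𝓝 T) := by
    simpa using (continuous_const_add T).tendsto 0
  have hMκ : 0 < M - κ := sub_pos.2 hκM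
  have hb := (continuousAt_blowupTime (p := (a, M - κ)) hMκ).tendsto.comp h1
  have hr := (continuousAt_riseTime zero_le_one (p := (a, M - κ)) hMκ).tendsto.comp h1
  have hr' := (continuousAt_riseTime zero_le_one (p := (a, M)) hM).tendsto.comp h2
  exact h3.eventually_lt ((hb.sub hr).add hr') hT

/-- At M = η⁴ the maximizing a blows up exactly at x₀ under constant force M. Reducing the force
after s = 1 delays this strictly, and by continuity the delay survives replacing M by M + ε. -/
theorem exists_mem_minPoints_lt {x₀ η : ℝ} (hx₀ : x₀ ≤ 0) (hη : 0 < η)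
    (hroot : η ^ 5 - |x₀| * η = C) : ∃ m ∈ minPoints x₀, m < -η ^ 4 := by
  obtain ⟨v, hv⟩ := exists_ellipticIntegral_eq_C
  obtain ⟨a, hτ⟩ : ∃ a, blowupTime a (η ^ 4) = x₀ + η ^ 4 := by
    refine ⟨η ^ 2 * v, ?_⟩
    rw [blowupTime_scaling hη, hv, ← hroot, abs_of_nonpos hx₀]
    field_simp
    ring
  have hMpos : 0 < η ^ 4 := by positivity
  generalize η ^ 4 = M at hτ hMpos
  have hτpos : 0 < x₀ + M := hτ ▸ blowupTime_pos a hMpos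
  -- Rise times decrease in the force, so M + 1 gives a choice of κ valid for every ε < 1.
  have hr : 0 < riseTime a (M + 1) 1 := by
    simpa using strictMono_riseTime a (by linarith : 0 < M + 1) one_pos
  obtain ⟨κ, hκ, hκM⟩ := exists_between
    (lt_min hMpos (by linarith : 0 < riseTime a (M + 1) 1 / 2))
  obtain ⟨hκM, hκr⟩ := lt_min_iff.1 hκM
  have hlt := blowupTime_lt_add a (sub_pos.2 hκM) (sub_lt_self M hκ) 1
  rw [hτ] at hlt
  have hev := eventually_lt_delayed_blowupTime hκM hMpos hlt
  obtain ⟨ε, hεg, hε0, hε1⟩ := ((hev.filter_mono (nhdsWithin_le_nhds (s := Ioi 0))).and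
    (Ioo_mem_nhdsGT zero_lt_one)).exists
  refine ⟨-(M + ε), neg_mem_minPoints (a := a) hκ (by linarith) (by linarith) hx₀ ?_ ?_,
    by linarith⟩
  · have := riseTime_antitone a (by linarith : 0 < M + ε) (by linarith : M + ε ≤ M + 1)
      zero_le_one
    linarith
  · linarith

/-! ### The root η and the explicit bounds -/

theorem existsUnique_root {k D : ℝ} (hk : 0 ≤ k) (hD : 0 < D) :
    ∃! η : ℝ, 0 < η ∧ η ^ 5 - k * η = D := by
  -- As η(η⁴ - k), the polynomial is a product of two increasing factors, both positive from any
  -- positive root onwards.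
  have hinj : ∀ a b : ℝ, 0 < a → a < b → a ^ 5 - k * a = D → a ^ 5 - k * a < b ^ 5 - k * b := by
    intro a b ha hab h
    have h1 : 0 < a ^ 4 - k := by
      have : a * (a ^ 4 - k) = D := by rw [← h]; ring
      exact pos_of_mul_pos_right (this ▸ hD) ha.le
    have h2 : a ^ 4 < b ^ 4 := by gcongr
    have h3 : a * (a ^ 4 - k) < b * (b ^ 4 - k) :=
      mul_lt_mul'' hab (by linarith) ha.le h1.le
    linarith
  set N := 1 + k + D with hN
  have hN1 : 1 ≤ N := by linarith
  have hNge : D ≤ N ^ 5 - k * N := by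
    have h1 : N ≤ N ^ 4 := le_self_pow₀ hN1 (by norm_num)
    have h2 : D ≤ N * (N ^ 4 - k) := by nlinarith
    linarith
  have hcont : ContinuousOn (fun η : ℝ => η ^ 5 - k * η) (Icc 0 N) := by fun_prop
  obtain ⟨η, hη, he⟩ := intermediate_value_Icc (by linarith : (0 : ℝ) ≤ N) hcont
    (show D ∈ Icc _ _ from ⟨by simpa using hD.le, hNge⟩)
  simp only at he
  have hη0 : 0 < η := hη.1.lt_of_ne fun e => by rw [← e] at he; simp at he; linarith
  refine ⟨η, ⟨hη0, he⟩, fun ξ ⟨hξ0, hξ⟩ => ?_⟩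
  rcases lt_trichotomy ξ η with h | h | h
  · have := hinj ξ η hξ0 h hξ; linarith
  · exact h
  · have := hinj η ξ hη0 h he; linarith

theorem Xmin_lt {x₀ η : ℝ} (hx₀ : x₀ ≤ 0) (hη : 0 < η) (hroot : η ^ 5 - |x₀| * η = C) :
    Xmin x₀ < -η ^ 4 := by
  obtain ⟨m, hm, hlt⟩ := exists_mem_minPoints_lt hx₀ hη hroot
  exact (csInf_le (bddBelow_minPoints hx₀) hm).trans_lt hlt

theorem neg_root_pow_eq {x₀ η : ℝ} (hx₀ : x₀ ≤ 0) (hη : 0 < η) (hroot : η ^ 5 - |x₀| * η = C) :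
    -η ^ 4 = x₀ - C / η := by
  rw [← hroot, abs_of_nonpos hx₀]
  field_simp
  ring

theorem minPoints_nonempty {x₀ : ℝ} (hx₀ : x₀ ≤ 0) : (minPoints x₀).Nonempty := by
  obtain ⟨η, ⟨hη, hroot⟩, -⟩ := existsUnique_root (abs_nonneg x₀) C_pos
  obtain ⟨m, hm, -⟩ := exists_mem_minPoints_lt hx₀ hη hroot
  exact ⟨m, hm⟩

theorem rpow_quarter_pow {k : ℝ} (hk : 0 ≤ k) : (k ^ (1 / 4 : ℝ)) ^ 4 = k := by
  rw [← Real.rpow_natCast, ← Real.rpow_mul hk]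
  norm_num

theorem sub_lt_Xmin {x₀ : ℝ} (hx₀ : x₀ < 0) : x₀ - C / |x₀| ^ (1 / 4 : ℝ) < Xmin x₀ := by
  obtain ⟨b, hb, h⟩ := exists_lt_forall_mem_minPoints_le
    (Real.rpow_pos_of_pos (abs_pos.2 hx₀.ne) (1 / 4))
  rw [rpow_quarter_pow (abs_nonneg _), abs_of_neg hx₀, neg_neg] at h
  rw [rpow_quarter_pow (abs_nonneg _), abs_of_neg hx₀, neg_neg, ← abs_of_neg hx₀] at hb
  exact hb.trans_le (le_csInf (minPoints_nonempty hx₀.le) h)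

/-- One step of the iteration η⁴ = |x₀| + C/η: from η ≥ |x₀|^(1/4) follows an upper bound for η,
hence a lower bound for C/η. -/
theorem Xmin_lt_sub {x₀ : ℝ} (hx₀ : x₀ < 0) :
    Xmin x₀ < x₀ - C / |(|x₀| + C / |x₀| ^ (1 / 4 : ℝ))| ^ (1 / 4 : ℝ) := by
  obtain ⟨η, ⟨hη, hroot⟩, -⟩ := existsUnique_root (abs_nonneg x₀) C_pos
  have h1 := Xmin_lt hx₀.le hη hroot
  have h2 := neg_root_pow_eq hx₀.le hη hroot
  have hk : 0 < |x₀| := abs_pos.2 hx₀.ne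
  have hq : 0 < |x₀| ^ (1 / 4 : ℝ) := Real.rpow_pos_of_pos hk _
  have hC := C_pos
  have hCη : 0 < C / η := div_pos hC hη
  have hqη : |x₀| ^ (1 / 4 : ℝ) ≤ η := by
    refine le_of_pow_le_pow_left₀ (n := 4) (by norm_num) hη.le ?_
    rw [rpow_quarter_pow hk.le, abs_of_neg hx₀]
    linarith
  have hle : η ≤ (|x₀| + C / |x₀| ^ (1 / 4 : ℝ)) ^ (1 / 4 : ℝ) := by
    refine le_of_pow_le_pow_left₀ (n := 4) (by norm_num) (by positivity) ?_
    rw [rpow_quarter_pow (by positivity)]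
    have : C / η ≤ C / |x₀| ^ (1 / 4 : ℝ) := by gcongr
    have : |x₀| = -x₀ := abs_of_neg hx₀
    linarith
  rw [abs_of_pos (by positivity : 0 < |x₀| + C / |x₀| ^ (1 / 4 : ℝ))]
  have : C / (|x₀| + C / |x₀| ^ (1 / 4 : ℝ)) ^ (1 / 4 : ℝ) ≤ C / η := by gcongr
  linarith

/-- The gap between the two bounds. -/
theorem div_rpow_sub_div_rpow_le {k D : ℝ} (hk : 0 < k) (hD : 0 < D) :
    D / k ^ (1 / 4 : ℝ) - D / |(k + D / k ^ (1 / 4 : ℝ))| ^ (1 / 4 : ℝ)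
      ≤ D ^ 2 / (4 * k ^ (3 / 2 : ℝ)) := by
  set q := k ^ (1 / 4 : ℝ) with hq
  have hq0 : 0 < q := Real.rpow_pos_of_pos hk _
  have hqk : q ^ 4 = k := rpow_quarter_pow hk.le
  have hq6 : k ^ (3 / 2 : ℝ) = q ^ 6 := by
    rw [hq, ← Real.rpow_natCast, ← Real.rpow_mul hk.le]; norm_num
  rw [hq6, abs_of_pos (by positivity)]
  set r := (k + D / q) ^ (1 / 4 : ℝ) with hr
  have hr0 : 0 < r := Real.rpow_pos_of_pos (by positivity) _
  have hr4 : r ^ 4 = q ^ 4 + D / q := by rw [hr, rpow_quarter_pow (by positivity), hqk]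
  have hD' : D = q * (r ^ 4 - q ^ 4) := by rw [hr4]; field_simp; ring
  have hqr : q < r := by
    refine lt_of_pow_lt_pow_left₀ 4 hr0.le ?_
    have : 0 < D / q := by positivity
    linarith
  -- With D = q(r⁴ - q⁴) the claim reduces to this, a consequence of r⁴ - q⁴ ≥ 4q³(r - q) and r > q.
  have key : 4 * q ^ 4 * (r - q) ≤ (r ^ 4 - q ^ 4) * r := by
    have h1 : 4 * q ^ 3 * (r - q) ≤ r ^ 4 - q ^ 4 := by
      have h2 : q ^ 3 ≤ r ^ 3 := by gcongr
      have h3 : q ^ 2 ≤ r ^ 2 := by gcongr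
      have h4 : 4 * q ^ 3 ≤ r ^ 3 + r ^ 2 * q + r * q ^ 2 + q ^ 3 := by nlinarith [sq_nonneg q]
      calc 4 * q ^ 3 * (r - q) ≤ (r ^ 3 + r ^ 2 * q + r * q ^ 2 + q ^ 3) * (r - q) :=
            mul_le_mul_of_nonneg_right h4 (by linarith)
        _ = r ^ 4 - q ^ 4 := by ring
    have h2 : 0 ≤ 4 * q ^ 3 * (r - q) := mul_nonneg (by positivity) (by linarith)
    nlinarith
  have he : D ^ 2 / (4 * q ^ 6) - (D / q - D / r)
      = D * ((r ^ 4 - q ^ 4) * r - 4 * q ^ 4 * (r - q)) / (4 * q ^ 5 * r) := by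
    rw [eq_div_iff (by positivity)]
    field_simp
    nth_rewrite 1 [hD']
    ring
  have : 0 ≤ D * ((r ^ 4 - q ^ 4) * r - 4 * q ^ 4 * (r - q)) / (4 * q ^ 5 * r) :=
    div_nonneg (mul_nonneg hD.le (by linarith)) (by positivity)
  linarith

theorem remainder_bounds {x₀ : ℝ} (hx₀ : x₀ < 0) :
    0 < Xmin x₀ - (x₀ - C / |x₀| ^ (1 / 4 : ℝ)) ∧
      Xmin x₀ - (x₀ - C / |x₀| ^ (1 / 4 : ℝ)) < C ^ 2 / (4 * |x₀| ^ (3 / 2 : ℝ)) := by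
  have h1 := sub_lt_Xmin hx₀
  have h2 := Xmin_lt_sub hx₀
  have h3 := div_rpow_sub_div_rpow_le (abs_pos.2 hx₀.ne) C_pos
  exact ⟨by linarith, by linarith⟩

theorem isBigO_remainder :
    Asymptotics.IsBigO atBot (fun x₀ : ℝ => Xmin x₀ - (x₀ - C / |x₀| ^ (1 / 4 : ℝ)))
      (fun x₀ : ℝ => 1 / |x₀| ^ (3 / 2 : ℝ)) := by
  refine Asymptotics.IsBigO.of_bound (C ^ 2 / 4) ?_
  filter_upwards [eventually_lt_atBot 0] with x₀ hx₀
  obtain ⟨h1, h2⟩ := remainder_bounds hx₀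
  have hk : 0 < |x₀| ^ (3 / 2 : ℝ) := Real.rpow_pos_of_pos (abs_pos.2 hx₀.ne) _
  rw [Real.norm_of_nonneg h1.le, Real.norm_of_nonneg (by positivity)]
  refine h2.le.trans_eq ?_
  field_simp

end PainleveOne

theorem corollary2p1 :
    -- `C` is indeed a maximum
    IsGreatest (PainleveOne.ellipticIntegral '' Set.Iio 0) PainleveOne.C ∧
    -- `X_min(x₀)` is the infimum of a nonempty set that is bounded below
    (∀ x₀ : ℝ, x₀ ≤ 0 →
      (PainleveOne.minPoints x₀).Nonempty ∧ BddBelow (PainleveOne.minPoints x₀)) ∧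
    -- the bound through the unique positive root `η` of `η⁵ - |x₀| η = C`
    (∀ x₀ : ℝ, x₀ ≤ 0 →
      (∃! η : ℝ, 0 < η ∧ η ^ 5 - |x₀| * η = PainleveOne.C) ∧
      ∀ η : ℝ, 0 < η → η ^ 5 - |x₀| * η = PainleveOne.C →
        PainleveOne.Xmin x₀ < -η ^ 4 ∧ -η ^ 4 = x₀ - PainleveOne.C / η) ∧
    -- the two-sided bound
    (∀ x₀ : ℝ, x₀ < 0 →
      x₀ - PainleveOne.C / |x₀| ^ (1 / 4 : ℝ) < PainleveOne.Xmin x₀ ∧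
      PainleveOne.Xmin x₀ <
        x₀ - PainleveOne.C /
          |(|x₀| + PainleveOne.C / |x₀| ^ (1 / 4 : ℝ))| ^ (1 / 4 : ℝ)) ∧
    -- the asymptotics as `x₀ → -∞`
    Asymptotics.IsBigO Filter.atBot
      (fun x₀ : ℝ => PainleveOne.Xmin x₀ - (x₀ - PainleveOne.C / |x₀| ^ (1 / 4 : ℝ)))
      (fun x₀ : ℝ => 1 / |x₀| ^ (3 / 2 : ℝ)) ∧
    -- the explicit bound on the remainder
    (∀ x₀ : ℝ, x₀ ≤ 0 → PainleveOne.C ^ (4 / 5 : ℝ) < |x₀| →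
      0 < PainleveOne.Xmin x₀ - (x₀ - PainleveOne.C / |x₀| ^ (1 / 4 : ℝ)) ∧
      PainleveOne.Xmin x₀ - (x₀ - PainleveOne.C / |x₀| ^ (1 / 4 : ℝ)) <
        PainleveOne.C ^ 2 / (4 * |x₀| ^ (3 / 2 : ℝ))) := by
  open PainleveOne in
  exact ⟨isGreatest_C, fun x₀ hx₀ => ⟨minPoints_nonempty hx₀, bddBelow_minPoints hx₀⟩,
    fun x₀ hx₀ => ⟨existsUnique_root (abs_nonneg x₀) C_pos,
      fun η hη hroot => ⟨Xmin_lt hx₀ hη hroot, neg_root_pow_eq hx₀ hη hroot⟩⟩,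
    fun x₀ hx₀ => ⟨sub_lt_Xmin hx₀, Xmin_lt_sub hx₀⟩, isBigO_remainder,
    fun x₀ hx₀ hlt => remainder_bounds (hx₀.lt_of_ne fun h => by
      rw [h, abs_zero] at hlt
      exact absurd hlt (not_lt.2 (Real.rpow_nonneg C_pos.le _)))⟩
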